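/- Let $K$ be an algebraically closed field, complete with respect to a nontrivial non-Archimedean absolute value $|\cdot|$, and let $p>1$ be a real number (the prime $p$ if $K=\mathbb{C}_p$). An open ball in $\mathbb{P}^1=K\cup\{\infty\}$ is a set $B=\{x\in K:|x-b|<r\}$ or $B=\mathbb{P}^1\setminus\{x\in K:|x-b|\le r\}$ with $b\in K$, $r>0$; the corresponding closed ball is $B^+=\{x\in K:|x-b|\le r\}$, respectively $B^+=\mathbb{P}^1\setminus\{x\in K:|x-b|<r\}$. In both cases let $P_B\in(\mathbb{P}^1)^{an}$ be the point of type 2 or 3 belonging to $\{x\in K:|x-b|\le r\}$. If $P_1,P_2$ are the points belonging to $\{|x-b_1|\le r_1\}$ and $\{|x-b_2|\le r_2\}$, and $R=\max(r_1,r_2,|b_1-b_2|)$ is the radius of the smallest such ball containing both, their distance is $\log_p(R/r_1)+\log_p(R/r_2)$. Let $\Gamma\le PGL(2,K)$ be a Schottky group, i.e. a finitely generated subgroup in which every non-identity element is hyperbolic (is represented by a matrix having two eigenvalues of different absolute value), and let $\gamma_1,\dots,\gamma_g$ be free generators of $\Gamma$. Suppose that they are in good position: there are open balls $B_1,\dots,B_g,B_1',\dots,B_g'$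 such that the $2g$ closed balls $B_i^+,B_i'^+$ are pairwise disjoint and $\gamma_i(\mathbb{P}^1\setminus B_i')=B_i^+$, $\gamma_i^{-1}(\mathbb{P}^1\setminus B_i)=B_i'^+$ for all $i$ (so $F=\mathbb{P}^1\setminus\bigcup_i(B_i\cup B_i')$ is a good fundamental domain). Let $c$ be the smallest pairwise distance between the $2g$ points $P_{B_1},\dots,P_{B_g},P_{B_1'},\dots,P_{B_g'}$. For $m\ge 0$ let $\Gamma_m$ be the set of elements of $\Gamma$ whose reduced word in $\gamma_1^{\pm1},\dots,\gamma_g^{\pm1}$ has length $\le m$, and put $$\Theta_m(a,b;z)=\prod_{\gamma\in\Gamma_m}\frac{z-\gamma a}{z-\gamma b},\qquad \Theta(a,b;z)=\prod_{\gamma\in\Gamma}\frac{z-\gamma a}{z-\gamma b},$$ where for $z\in K$ a difference $z-\infty$ is read as the constant $-1$ (these constants cancel in the quotients below). Let $\Sigma\subset\mathbb{P}^1$ be the set of fixed points of non-identity elements of $\Gamma$ together with their limit points, in the topology generated by the open balls. Let $m\ge1$, let $1\le i,j\le g$, and let $a\in B_i'^+\setminus B_i'$ and $z\in B_j'^+\setminus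 B_j'$ with $a\ne z$. Then the product $$Q=\prod_{\gamma\in\Gamma}\frac{(z-\gamma a)(\gamma_jz-\gamma\gamma_ia)}{(z-\gamma\gamma_ia)(\gamma_jz-\gamma a)}$$ converges unconditionally, $Q\neq0$, and $$\left|\frac{\Theta_m(a,\gamma_ia;z)/\Theta_m(a,\gamma_ia;\gamma_jz)}{Q}-1\right|\le p^{-cm}.$$ If moreover $\infty\notin\Sigma$, then the products $\Theta(a,\gamma_ia;z)$ and $\Theta(a,\gamma_ia;\gamma_jz)$ converge unconditionally and are nonzero, and $$\left|\frac{\Theta_m(a,\gamma_ia;z)/\Theta_m(a,\gamma_ia;\gamma_jz)}{\Theta(a,\gamma_ia;z)/\Theta(a,\gamma_ia;\gamma_jz)}-1\right|\le p^{-cm}.$$ -/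

import Mathlib

open scoped MatrixGroups

noncomputable section

namespace MumfordCurve

/-- Scalar matrices act trivially on the projective line `OnePoint K = K ∪ {∞}`. -/
theorem scalar_smul_onePoint {K : Type*} [Field K] [DecidableEq K] (u : Kˣ) (x : OnePoint K) :
    Matrix.GeneralLinearGroup.scalar (Fin 2) u • x = x := by
  induction x using OnePoint.rec with
  | infty => simp [OnePoint.smul_infty_eq_ite]
  | coe t => simp [OnePoint.smul_some_eq_ite]

open Classical in
/-- `PGL(2, K)` acts on `ℙ¹(K) = OnePoint K` by Möbius transformations. -/
instance instPGLAction {K : Type*} [Field K] : MulAction PGL(2, K) (OnePoint K) :=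
  Matrix.ProjGenLinGroup.mulActionOfGL scalar_smul_onePoint

/-- An element of `PGL(2, K)` is hyperbolic if a representing matrix has two eigenvalues
of different absolute value (this does not depend on the representing matrix). -/
def IsHyperbolic {K : Type*} [NormedField K] (δ : PGL(2, K)) : Prop :=
  ∃ A : GL (Fin 2) K, Matrix.ProjGenLinGroup.mk A = δ ∧
    ∃ s t : K, Module.End.HasEigenvalue (Matrix.toLin' (A : Matrix (Fin 2) (Fin 2) K)) s ∧
      Module.End.HasEigenvalue (Matrix.toLin' (A : Matrix (Fin 2) (Fin 2) K)) t ∧ ‖s‖ ≠ ‖t‖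

/-- A Schottky group: finitely generated, and every non-identity element is hyperbolic. -/
structure IsSchottky {K : Type*} [NormedField K] (Γ : Subgroup PGL(2, K)) : Prop where
  fg : Γ.FG
  hyperbolic : ∀ δ ∈ Γ, δ ≠ 1 → IsHyperbolic δ

/-- A ball in `ℙ¹(K)`, given by a centre `a : K`, a radius `r > 0` and a side: either the usual
side (not containing `∞`), or the side containing `∞`. -/
structure Ball (K : Type*) where
  center : K
  radius : ℝ
  radius_pos : 0 < radius
  atInfinity : Bool

/-- The open ball: `{x | |x - a| < r}` or `ℙ¹ ∖ {x | |x - a| ≤ r}`. -/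
def Ball.openSet {K : Type*} [NormedField K] (B : Ball K) : Set (OnePoint K) :=
  if B.atInfinity then ((↑) '' Metric.closedBall B.center B.radius : Set (OnePoint K))ᶜ
  else (↑) '' Metric.ball B.center B.radius

/-- The corresponding closed ball: `{x | |x - a| ≤ r}` or `ℙ¹ ∖ {x | |x - a| < r}`. -/
def Ball.closedSet {K : Type*} [NormedField K] (B : Ball K) : Set (OnePoint K) :=
  if B.atInfinity then ((↑) '' Metric.ball B.center B.radius : Set (OnePoint K))ᶜ
  else (↑) '' Metric.closedBall B.center B.radius

/-- The radius of the smallest usual closed ball that contains both `{x | |x - a| ≤ r}` and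
`{x | |x - b| ≤ s}`, where `a, r` and `b, s` are the centres and radii of `B` and `C`. -/
def joinRadius {K : Type*} [NormedField K] (B C : Ball K) : ℝ :=
  max (max B.radius C.radius) ‖B.center - C.center‖

/-- The distance (to base `p`) in `(ℙ¹)ᵃⁿ` between the points of type 2 or 3 that belong to two
balls. The point of a ball with centre `a` and radius `r` is the one of the usual closed ball
`{x | |x - a| ≤ r}`; for a ball on the side of `∞` this is the boundary point of the ball as well,
so that the definition is compatible with the action of `PGL(2, K)`.
The distance runs through the point of the smallest closed ball that contains both. -/
def pointDist {K : Type*} [NormedField K] (p : ℝ) (B C : Ball K) : ℝ :=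
  Real.logb p (joinRadius B C / B.radius) + Real.logb p (joinRadius B C / C.radius)

/-- The balls `B₁, …, B_g, B₁', …, B_g'` in one family. -/
def allBalls {K : Type*} {g : ℕ} (B B' : Fin g → Ball K) : Fin g ⊕ Fin g → Ball K :=
  Sum.elim B B'

/-- `c`: the smallest distance between two of the `2g` points in `(ℙ¹)ᵃⁿ`. -/
def minDist {K : Type*} [NormedField K] (p : ℝ) {g : ℕ} (B B' : Fin g → Ball K) : ℝ :=
  ⨅ q : {q : (Fin g ⊕ Fin g) × (Fin g ⊕ Fin g) // q.1 ≠ q.2},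
    pointDist p (allBalls B B' q.1.1) (allBalls B B' q.1.2)

/-- The balls `Bᵢ, Bᵢ'` define a good fundamental domain `ℙ¹ ∖ ⋃ (Bᵢ ∪ Bᵢ')` for `γ₁, …, γ_g`. -/
structure IsGoodFundamentalDomain {K : Type*} [NormedField K] {g : ℕ} (γ : Fin g → PGL(2, K))
    (B B' : Fin g → Ball K) : Prop where
  disjoint : Pairwise fun k l =>
    Disjoint (allBalls B B' k).closedSet (allBalls B B' l).closedSet
  image : ∀ i, (fun x => γ i • x) '' (B' i).openSetᶜ = (B i).closedSet
  image_inv : ∀ i, (fun x => (γ i)⁻¹ • x) '' (B i).openSetᶜ = (B' i).closedSet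

/-- The set of fixed points of the non-identity elements of `Γ`. -/
def fixedPts {K : Type*} [Field K] (Γ : Subgroup PGL(2, K)) : Set (OnePoint K) :=
  {x | ∃ δ ∈ Γ, δ ≠ 1 ∧ δ • x = x}

/-- The set `Σ` of bad points: fixed points of non-identity elements of `Γ` and their limit points,
in the topology of `ℙ¹(K)` generated by the open balls (for `K` not locally compact this is not
the topology that `OnePoint K` carries, so the closure is spelled out). -/
def badPts {K : Type*} [NormedField K] (Γ : Subgroup PGL(2, K)) : Set (OnePoint K) :=
  {x | ∀ U : Ball K, x ∈ U.openSet → (U.openSet ∩ fixedPts Γ).Nonempty}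

/-- `Γ_m`: the elements `h₁ ⋯ h_k` with `k ≤ m`, `h_l ∈ {γ₁^±, …, γ_g^±}`, `h_l ≠ h_{l+1}⁻¹`. -/
def wordBall {G : Type*} [Group G] {g : ℕ} (γ : Fin g → G) (m : ℕ) : Set G :=
  {δ | ∃ L : List (Fin g × Bool), L.length ≤ m ∧ FreeGroup.IsReduced L ∧
    FreeGroup.lift γ (FreeGroup.mk L) = δ}

theorem wordBall_finite {G : Type*} [Group G] {g : ℕ} (γ : Fin g → G) (m : ℕ) :
    (wordBall γ m).Finite :=
  ((List.finite_length_le (Fin g × Bool) m).image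
    fun L => FreeGroup.lift γ (FreeGroup.mk L)).subset
    fun _ ⟨L, hL, _, h⟩ => ⟨L, hL, h⟩

/-- The difference `x - y` on `ℙ¹(K)`: it is `x₁ y₂ - x₂ y₁` for the representatives
`x = (x : 1)` of a finite point and `∞ = (1 : 0)`. -/
def diff {K : Type*} [Field K] (x y : OnePoint K) : K :=
  x.elim (y.elim 0 fun _ => 1) fun s => y.elim (-1) fun t => s - t

/-- The factor `(z - a) / (z - b)` of a theta function. For finite points it is the literal
quotient; for finite `z`, if `a` or `b` is `∞`, its difference from `z` is replaced by the constant
`-1`; these constants cancel in quotients `factor a b z / factor a b w`, which are cross ratios. -/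
def factor {K : Type*} [Field K] (a b z : OnePoint K) : K :=
  diff z a / diff z b

/-- The truncated theta function `Θ_m(a, b; z) = ∏_{δ ∈ Γ_m} (z - δ a) / (z - δ b)`. -/
def thetaTrunc {K : Type*} [Field K] {g : ℕ} (γ : Fin g → PGL(2, K)) (m : ℕ)
    (a b z : OnePoint K) : K :=
  ∏ δ ∈ (wordBall_finite γ m).toFinset, factor (δ • a) (δ • b) z

/-- The theta function `Θ(a, b; z) = ∏_{δ ∈ Γ} (z - δ a) / (z - δ b)` (an unconditional product). -/
def theta {K : Type*} [NormedField K] (Γ : Subgroup PGL(2, K)) (a b z : OnePoint K) : K :=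
  ∏' δ : Γ, factor ((δ : PGL(2, K)) • a) ((δ : PGL(2, K)) • b) z

/-- The theta quotient `Θ(a, b; z) / Θ(a, b; w)` as one product of cross ratios
`∏_{δ ∈ Γ} ((z - δ a) / (z - δ b)) / ((w - δ a) / (w - δ b))`. It is meaningful also if `∞` is a
bad point, when the products for `Θ(a, b; z)` and `Θ(a, b; w)` need not converge separately. -/
def thetaQuot {K : Type*} [NormedField K] (Γ : Subgroup PGL(2, K)) (a b z w : OnePoint K) : K :=
  ∏' δ : Γ, factor ((δ : PGL(2, K)) • a) ((δ : PGL(2, K)) • b) z /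
    factor ((δ : PGL(2, K)) • a) ((δ : PGL(2, K)) • b) w

end MumfordCurve

end

/-! Each factor of `Q` is a cross ratio, and its deviation from 1 is the expression `crossDev`,
which is invariant under PGL(2, K). If z, w lie in one closed ball of the configuration and x, y in
another, the norm of this deviation is exactly the width of z, w times the width of x, y times
p^(-distance of the two ball points) (`norm_crossDev_eq`), and widths are at most 1. Conversely, the
width of a pair is controlled by its cross ratios with points outside the ball
(`Ball.width_le_of_forall_crossDev_le`). By invariance, every letter therefore contracts widths by q
= p^(-c) (`IsPingPong.width_smul_le`).

Take z, w, x, y in F and translate x, y by a reduced word of length n ≥ 2. Moving its first letter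
over to z, w puts these two into a common ball; the other n - 1 letters give the bound q^(n-1),
which is at most q^m when n > m. Ultrametric products do not accumulate errors: factors within ε < 1
of 1 have a product within ε of 1. Hence the part of `Q` outside Γ_m is within q^m of 1, which gives
both convergence and the estimate.

A single theta factor is the same cross ratio with w = ∞, and ∞ need not lie in F. If ∞ is not in Σ,
the inverse of every sufficiently long prefix moves ∞ into the right ball, since otherwise fixed
points would come arbitrarily close to ∞. So the factors again tend to 1, both theta products
converge, and their quotient is `Q`. -/

open scoped MatrixGroups

noncomputable section

namespace MumfordCurve

/-! ### Differences and cross ratios on the projective line. -/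

section Projective

variable {K : Type*} [Field K]

open Classical in
theorem mk_smul_onePoint (A : GL (Fin 2) K) (x : OnePoint K) :
    (Matrix.ProjGenLinGroup.mk A : PGL(2, K)) • x = A • x := rfl

@[simp] theorem diff_infty_infty : diff (OnePoint.infty : OnePoint K) OnePoint.infty = 0 := rfl
@[simp] theorem diff_infty_coe (t : K) : diff OnePoint.infty (t : OnePoint K) = 1 := rfl
@[simp] theorem diff_coe_infty (t : K) : diff (t : OnePoint K) OnePoint.infty = -1 := rfl
@[simp] theorem diff_coe_coe (s t : K) : diff (s : OnePoint K) (t : OnePoint K) = s - t := rfl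

theorem diff_eq_zero_iff {x y : OnePoint K} : diff x y = 0 ↔ x = y := by
  induction x using OnePoint.rec <;> induction y using OnePoint.rec <;>
    simp [sub_eq_zero]

theorem diff_ne_zero {x y : OnePoint K} (h : x ≠ y) : diff x y ≠ 0 :=
  fun h' => h (diff_eq_zero_iff.1 h')

theorem diff_comm (x y : OnePoint K) : diff x y = -diff y x := by
  induction x using OnePoint.rec <;> induction y using OnePoint.rec <;> simp

theorem diff_plucker (z w x y : OnePoint K) :
    diff z x * diff w y - diff z y * diff w x = diff z w * diff x y := by
  induction x using OnePoint.rec <;> induction y using OnePoint.rec <;>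
    induction z using OnePoint.rec <;> induction w using OnePoint.rec <;> (simp; try ring)

/-- Homogeneous coordinates: `(t : 1)` for a finite point `t`, and `∞ = (1 : 0)`. -/
def homogCoord (x : OnePoint K) : K × K := x.elim (1, 0) fun t => (t, 1)

theorem diff_eq_homogCoord (x y : OnePoint K) :
    diff x y = (homogCoord x).1 * (homogCoord y).2 - (homogCoord x).2 * (homogCoord y).1 := by
  induction x using OnePoint.rec <;> induction y using OnePoint.rec <;> simp [homogCoord]

open Classical in
theorem exists_homogCoord_smul (A : GL (Fin 2) K) (x : OnePoint K) :
    ∃ c : K, c ≠ 0 ∧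
      A 0 0 * (homogCoord x).1 + A 0 1 * (homogCoord x).2 = c * (homogCoord (A • x)).1 ∧
      A 1 0 * (homogCoord x).1 + A 1 1 * (homogCoord x).2 = c * (homogCoord (A • x)).2 := by
  have hdet : A 0 0 * A 1 1 - A 0 1 * A 1 0 ≠ 0 := by
    have := A.det_ne_zero
    rwa [Matrix.det_fin_two] at this
  induction x using OnePoint.rec with
  | infty =>
    rw [OnePoint.smul_infty_eq_ite]
    by_cases h : A 1 0 = 0
    · refine ⟨A 0 0, fun h' => hdet (by rw [h, h']; ring), ?_⟩
      simp [homogCoord, h]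
    · exact ⟨A 1 0, h, by simp [homogCoord, h, mul_div_cancel₀]⟩
  | coe t =>
    rw [OnePoint.smul_some_eq_ite]
    by_cases h : A 1 0 * t + A 1 1 = 0
    · refine ⟨A 0 0 * t + A 0 1, fun h' => hdet ?_, ?_⟩
      · by_cases h0 : A 1 0 = 0
        · have h1 : A 1 1 = 0 := by simpa [h0] using h
          rw [h0, h1]; ring
        · have : A 1 0 * (A 0 0 * A 1 1 - A 0 1 * A 1 0) = 0 := by
            linear_combination A 0 0 * A 1 0 * h - A 1 0 * A 1 0 * h'
          exact (mul_eq_zero.1 this).resolve_left h0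
      · simp [homogCoord, h]
    · exact ⟨A 1 0 * t + A 1 1, h, by simp [homogCoord, h, mul_div_cancel₀]⟩

/-- Möbius transformations act on differences through a cocycle. -/
theorem exists_diff_smul (δ : PGL(2, K)) :
    ∃ (k : K) (j : OnePoint K → K), k ≠ 0 ∧ (∀ x, j x ≠ 0) ∧
      ∀ x y, diff (δ • x) (δ • y) = k / (j x * j y) * diff x y := by
  classical
  obtain ⟨A, rfl⟩ := Matrix.ProjGenLinGroup.mk_surjective δ
  choose j hj h0 h1 using exists_homogCoord_smul A
  refine ⟨A 0 0 * A 1 1 - A 0 1 * A 1 0, j, ?_, hj, fun x y => ?_⟩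
  · have := A.det_ne_zero
    rwa [Matrix.det_fin_two] at this
  · have := hj x
    have := hj y
    simp only [mk_smul_onePoint]
    rw [div_mul_eq_mul_div, eq_div_iff (by positivity), diff_eq_homogCoord, diff_eq_homogCoord x y]
    calc _ = (j x * (homogCoord (A • x)).1) * (j y * (homogCoord (A • y)).2)
          - (j x * (homogCoord (A • x)).2) * (j y * (homogCoord (A • y)).1) := by ring
      _ = _ := by rw [← h0, ← h0, ← h1, ← h1]; ring

/-- The deviation from `1` of the cross ratio `(z - x) (w - y) / ((z - y) (w - x))`. -/
def crossDev (z w x y : OnePoint K) : K :=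
  diff z w * diff x y / (diff z y * diff w x)

/-- Each of the four points occurs once above and once below, so the cocycle cancels. If a
denominator vanishes, both sides are 0 by the convention for division. -/
theorem crossDev_smul (δ : PGL(2, K)) (z w x y : OnePoint K) :
    crossDev (δ • z) (δ • w) (δ • x) (δ • y) = crossDev z w x y := by
  obtain ⟨k, j, hk, hj, h⟩ := exists_diff_smul δ
  simp only [crossDev, h]
  have := hj x; have := hj y; have := hj z; have := hj w
  by_cases h1 : diff z y = 0
  · simp [h1]
  by_cases h2 : diff w x = 0
  · simp [h2]
  field_simp

theorem factor_div_factor_sub_one {z w x y : OnePoint K} (hzy : z ≠ y) (hwx : w ≠ x)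
    (hwy : w ≠ y) : factor x y z / factor x y w - 1 = crossDev z w x y := by
  have h1 := diff_ne_zero hzy
  have h2 := diff_ne_zero hwx
  have h3 := diff_ne_zero hwy
  rw [crossDev, ← diff_plucker, factor, factor]
  field_simp

/-- For finite x and y the differences from ∞ are 1, so a single theta factor is a cross ratio with
fourth point ∞. -/
theorem factor_sub_one {z : OnePoint K} {x y : K} (hzy : z ≠ y) :
    factor x y z - 1 = crossDev z OnePoint.infty x y := by
  have h1 := diff_ne_zero hzy
  have h := diff_plucker z OnePoint.infty (x : OnePoint K) (y : OnePoint K)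
  simp only [diff_infty_coe, mul_one] at h
  rw [crossDev, ← h, factor, diff_infty_coe]
  field_simp

theorem factor_ne_zero {x y z : OnePoint K} (hx : z ≠ x) (hy : z ≠ y) : factor x y z ≠ 0 :=
  div_ne_zero (diff_ne_zero hx) (diff_ne_zero hy)

end Projective

/-- The fixed points are the two eigenlines; they differ because the eigenvalues do. -/
theorem IsHyperbolic.exists_fixed {K : Type*} [NormedField K] {δ : PGL(2, K)}
    (h : IsHyperbolic δ) : ∃ x y : OnePoint K, x ≠ y ∧ δ • x = x ∧ δ • y = y := by
  classical
  obtain ⟨A, rfl, s, t, hs, ht, hst⟩ := h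
  have hst : s ≠ t := fun e => hst (by rw [e])
  obtain ⟨v, hv⟩ := hs.exists_hasEigenvector
  obtain ⟨w, hw⟩ := ht.exists_hasEigenvector
  have hAv : A • v = s • v := by
    have := hv.apply_eq_smul
    rwa [Matrix.toLin'_apply] at this
  have hAw : A • w = t • w := by
    have := hw.apply_eq_smul
    rwa [Matrix.toLin'_apply] at this
  have fix : ∀ (r : K) (u : Fin 2 → K) (hu : u ≠ 0), A • u = r • u →
      (Matrix.ProjGenLinGroup.mk A : PGL(2, K)) •
        (OnePoint.equivProjectivization K).symm (Projectivization.mk K u hu) =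
        (OnePoint.equivProjectivization K).symm (Projectivization.mk K u hu) := by
    intro r u hu h
    rw [mk_smul_onePoint, Equiv.eq_symm_apply]
    have : A • (OnePoint.equivProjectivization K).symm (Projectivization.mk K u hu) =
      (OnePoint.equivProjectivization K).symm (A • Projectivization.mk K u hu) := by
      rw [Equiv.eq_symm_apply, OnePoint.equivProjectivization_smul, Equiv.apply_symm_apply]
    refine (congrArg _ this).trans ?_
    rw [Equiv.apply_symm_apply, Projectivization.smul_mk, Projectivization.mk_eq_mk_iff']
    exact ⟨r, h.symm⟩
  refine ⟨_, _, fun e => ?_, fix s v hv.2 hAv, fix t w hw.2 hAw⟩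
  obtain ⟨a, ha⟩ := (Projectivization.mk_eq_mk_iff' K v w hv.2 hw.2).1
    ((OnePoint.equivProjectivization K).symm.injective e)
  have h1 : A • v = t • v := by rw [← ha, smul_comm A a w, hAw, smul_comm]
  rw [hAv] at h1
  have : (s - t) • v = 0 := by rw [sub_smul, h1, sub_self]
  rcases smul_eq_zero.1 this with h2 | h2
  · exact hst (sub_eq_zero.1 h2)
  · exact hv.2 h2

/-! ### Ultrametric inequalities and density of the value group. -/

section Ultrametric

variable {K : Type*} [NormedField K] [IsUltrametricDist K]

theorem norm_sub_le_max_of_ultrametric (u v : K) : ‖u - v‖ ≤ max ‖u‖ ‖v‖ := by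
  simpa [sub_eq_add_neg] using IsUltrametricDist.norm_add_le_max u (-v)

theorem norm_add_eq_of_lt {u v : K} (h : ‖u‖ < ‖v‖) : ‖v + u‖ = ‖v‖ := by
  rw [IsUltrametricDist.norm_add_eq_max_of_norm_ne_norm h.ne', max_eq_left h.le]

theorem norm_sub_eq_of_lt {u v : K} (h : ‖u‖ < ‖v‖) : ‖v - u‖ = ‖v‖ := by
  rw [sub_eq_add_neg, norm_add_eq_of_lt (by rwa [norm_neg])]

theorem norm_sub_le_of_le {u v : K} {r : ℝ} (hu : ‖u‖ ≤ r) (hv : ‖v‖ ≤ r) : ‖u - v‖ ≤ r :=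
  (norm_sub_le_max_of_ultrametric u v).trans (max_le hu hv)

theorem norm_sub_lt_of_lt {u v : K} {r : ℝ} (hu : ‖u‖ < r) (hv : ‖v‖ < r) : ‖u - v‖ < r :=
  (norm_sub_le_max_of_ultrametric u v).trans_lt (max_lt hu hv)

end Ultrametric

/-- Roots of an element of norm > 1 have norms > 1 arbitrarily close to 1; powers of such a root
cannot jump over the interval. -/
theorem exists_norm_between {K : Type*} [NontriviallyNormedField K] [IsAlgClosed K] {x y : ℝ}
    (hx : 0 < x) (hxy : x < y) : ∃ u : K, x < ‖u‖ ∧ ‖u‖ < y := by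
  obtain ⟨π, hπ⟩ := NormedField.exists_one_lt_norm K
  have hq : 1 < y / x := (one_lt_div hx).2 hxy
  obtain ⟨n, hn⟩ := pow_unbounded_of_one_lt ‖π‖ hq
  have hn0 : n ≠ 0 := by
    rintro rfl
    simp only [pow_zero] at hn
    linarith
  obtain ⟨ρ, hρ⟩ := IsAlgClosed.exists_pow_nat_eq π (Nat.pos_of_ne_zero hn0)
  have h1 : 1 < ‖ρ‖ := by
    by_contra h
    have : ‖ρ‖ ^ n ≤ 1 := pow_le_one₀ (norm_nonneg _) (not_lt.1 h)
    rw [← norm_pow, hρ] at this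
    linarith
  have h2 : ‖ρ‖ < y / x := by
    rw [← hρ, norm_pow] at hn
    exact lt_of_pow_lt_pow_left₀ n (by positivity) hn
  obtain ⟨k, hk, hk'⟩ := exists_mem_Ico_zpow hx h1
  refine ⟨ρ ^ (k + 1), by rwa [norm_zpow], ?_⟩
  rw [norm_zpow, zpow_add_one₀ (by positivity)]
  calc ‖ρ‖ ^ k * ‖ρ‖ ≤ x * ‖ρ‖ := by gcongr
    _ < x * (y / x) := by gcongr
    _ = y := by field_simp

/-! ### Balls, widths of pairs of points, and distances of balls. -/

section Ball

variable {K : Type*} [NormedField K]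

theorem mem_openSet_coe (B : Ball K) (x : K) : (x : OnePoint K) ∈ B.openSet ↔
    if B.atInfinity then B.radius < ‖x - B.center‖ else ‖x - B.center‖ < B.radius := by
  unfold Ball.openSet
  split_ifs <;> simp [dist_eq_norm]

theorem mem_closedSet_coe (B : Ball K) (x : K) : (x : OnePoint K) ∈ B.closedSet ↔
    if B.atInfinity then B.radius ≤ ‖x - B.center‖ else ‖x - B.center‖ ≤ B.radius := by
  unfold Ball.closedSet
  split_ifs <;> simp [dist_eq_norm]

theorem infty_mem_openSet (B : Ball K) : OnePoint.infty ∈ B.openSet ↔ B.atInfinity := by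
  unfold Ball.openSet
  split_ifs with h <;> simp [h]

theorem infty_mem_closedSet (B : Ball K) : OnePoint.infty ∈ B.closedSet ↔ B.atInfinity := by
  unfold Ball.closedSet
  split_ifs with h <;> simp [h]

theorem Ball.openSet_subset_closedSet (B : Ball K) : B.openSet ⊆ B.closedSet := by
  intro x hx
  induction x using OnePoint.rec with
  | infty => rwa [infty_mem_closedSet, ← infty_mem_openSet]
  | coe x =>
    rw [mem_closedSet_coe]
    rw [mem_openSet_coe] at hx
    split_ifs at hx ⊢ <;> exact hx.le

/-- The size of the pair `x, y` relative to the ball `B`, at most `1` on the closed ball. -/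
def Ball.width (B : Ball K) (x y : OnePoint K) : ℝ :=
  if B.atInfinity then B.radius * ‖diff x y‖ / (‖diff x B.center‖ * ‖diff y B.center‖)
  else ‖diff x y‖ / B.radius

theorem Ball.width_nonneg (B : Ball K) (x y : OnePoint K) : 0 ≤ B.width x y := by
  have := B.radius_pos
  unfold Ball.width
  split_ifs <;> positivity

theorem Ball.eq_of_width_eq_zero (B : Ball K) {x y : OnePoint K} (hx : x ∈ B.closedSet)
    (hy : y ∈ B.closedSet) (h : B.width x y = 0) : x = y := by
  have hr := B.radius_pos
  rw [← diff_eq_zero_iff, ← norm_eq_zero]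
  unfold Ball.width at h
  split_ifs at h with hB
  · have key : ∀ z ∈ B.closedSet, ‖diff z B.center‖ ≠ 0 := by
      intro z hz h0
      rw [norm_eq_zero, diff_eq_zero_iff] at h0
      rw [h0, mem_closedSet_coe, if_pos hB] at hz
      simp at hz
      linarith
    have h1 := key x hx
    have h2 := key y hy
    simpa [hr.ne', h1, h2] using h
  · simpa [hr.ne'] using h

theorem norm_diff_comm (x y : OnePoint K) : ‖diff x y‖ = ‖diff y x‖ := by
  rw [diff_comm, norm_neg]

theorem norm_crossDev_comm (z w x y : OnePoint K) :
    ‖crossDev z w x y‖ = ‖crossDev x y z w‖ := by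
  simp only [crossDev, norm_div, norm_mul]
  rw [norm_diff_comm z y, norm_diff_comm w x]
  ring

/-- `p` to the power minus the distance of the points of the two balls. -/
def ballRatio (B C : Ball K) : ℝ := B.radius * C.radius / joinRadius B C ^ 2

theorem joinRadius_comm (B C : Ball K) : joinRadius B C = joinRadius C B := by
  rw [joinRadius, joinRadius, max_comm B.radius, norm_sub_rev]

theorem ballRatio_comm (B C : Ball K) : ballRatio B C = ballRatio C B := by
  rw [ballRatio, ballRatio, joinRadius_comm, mul_comm B.radius]

theorem joinRadius_pos (B C : Ball K) : 0 < joinRadius B C :=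
  lt_max_of_lt_left (lt_max_of_lt_left B.radius_pos)

theorem ballRatio_pos (B C : Ball K) : 0 < ballRatio B C :=
  div_pos (mul_pos B.radius_pos C.radius_pos) (pow_pos (joinRadius_pos B C) 2)

theorem rpow_neg_pointDist {p : ℝ} (hp : 1 < p) (B C : Ball K) :
    p ^ (-pointDist p B C) = ballRatio B C := by
  have h := joinRadius_pos B C
  have hB := B.radius_pos
  have hC := C.radius_pos
  rw [pointDist, ← Real.logb_mul (by positivity) (by positivity), ← Real.logb_inv,
    Real.rpow_logb (by linarith) hp.ne' (by positivity), ballRatio]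
  field_simp

theorem radius_lt_norm_center_sub {B C : Ball K} (hd : Disjoint B.closedSet C.closedSet)
    (hB : B.atInfinity = false) (hC : C.atInfinity = false) :
    B.radius < ‖B.center - C.center‖ := by
  have h1 : (C.center : OnePoint K) ∈ C.closedSet := by
    simp [mem_closedSet_coe, hC, C.radius_pos.le]
  have h2 := Set.disjoint_right.1 hd h1
  rw [norm_sub_rev]
  simpa [mem_closedSet_coe, hB] using h2

theorem norm_center_sub_lt_radius {B C : Ball K} (hd : Disjoint B.closedSet C.closedSet)
    (hB : B.atInfinity) (hC : C.atInfinity = false) :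
    ‖C.center - B.center‖ < B.radius := by
  have h1 : (C.center : OnePoint K) ∈ C.closedSet := by
    simp [mem_closedSet_coe, hC, C.radius_pos.le]
  have h2 := Set.disjoint_right.1 hd h1
  simpa [mem_closedSet_coe, hB] using h2

theorem not_both_atInfinity {B C : Ball K} (hd : Disjoint B.closedSet C.closedSet)
    (hB : B.atInfinity) : C.atInfinity = false := by
  by_contra h
  exact Set.disjoint_left.1 hd ((infty_mem_closedSet B).2 hB)
    ((infty_mem_closedSet C).2 (by simpa using h))

theorem joinRadius_of_finite {B C : Ball K} (hd : Disjoint B.closedSet C.closedSet)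
    (hB : B.atInfinity = false) (hC : C.atInfinity = false) :
    joinRadius B C = ‖B.center - C.center‖ := by
  have h1 := radius_lt_norm_center_sub hd hB hC
  have h2 := radius_lt_norm_center_sub hd.symm hC hB
  rw [norm_sub_rev] at h2
  exact max_eq_right (max_le h1.le h2.le)

variable [IsUltrametricDist K]

theorem Ball.width_le_one (B : Ball K) {x y : OnePoint K} (hx : x ∈ B.closedSet)
    (hy : y ∈ B.closedSet) : B.width x y ≤ 1 := by
  have hr := B.radius_pos
  unfold Ball.width
  split_ifs with h
  · have key : ∀ s : K, (s : OnePoint K) ∈ B.closedSet → B.radius ≤ ‖s - B.center‖ := by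
      intro s hs
      simpa [mem_closedSet_coe, h] using hs
    induction x using OnePoint.rec with
    | infty =>
      induction y using OnePoint.rec with
      | infty => simp
      | coe t =>
        have := key t hy
        simpa using div_le_one_of_le₀ this (norm_nonneg _)
    | coe s =>
      induction y using OnePoint.rec with
      | infty =>
        have := key s hx
        simpa using div_le_one_of_le₀ this (norm_nonneg _)
      | coe t =>
        have h1 := key t hy
        have h2 := key s hx
        simp only [diff_coe_coe]
        refine div_le_one_of_le₀ ?_ (by positivity)
        have h3 : ‖s - t‖ ≤ max ‖s - B.center‖ ‖t - B.center‖ := by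
          have := norm_sub_le_max_of_ultrametric (s - B.center) (t - B.center)
          simpa using this
        -- The larger distance to the centre bounds the distance of the points, and the smaller one
        -- is at least the radius.
        rcases le_max_iff.1 h3 with h4 | h4
        · calc _ ≤ ‖t - B.center‖ * ‖s - B.center‖ := by gcongr
            _ = _ := mul_comm _ _
        · gcongr
  · induction x using OnePoint.rec with
    | infty => simp [infty_mem_closedSet, h] at hx
    | coe s =>
      induction y using OnePoint.rec with
      | infty => simp [infty_mem_closedSet, h] at hy
      | coe t =>
        simp only [mem_closedSet_coe, h] at hx hy
        refine div_le_one_of_le₀ ?_ hr.le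
        have := norm_sub_le_of_le hx hy
        simpa using this

end Ball

/-! ### Cross ratios of two pairs in disjoint balls. -/

section Separation

variable {K : Type*} [NormedField K] [IsUltrametricDist K]

/-- The point `a` is essential: for a radius that is not a value of the norm, two disjoint closed
balls can be complementary and have the same radius. -/
theorem radius_lt_radius {B C : Ball K} (hd : Disjoint B.closedSet C.closedSet)
    (hB : B.atInfinity) (hC : C.atInfinity = false) {a : OnePoint K} (haB : a ∉ B.openSet)
    (haC : a ∉ C.openSet) : C.radius < B.radius := by
  have h1 := norm_center_sub_lt_radius hd hB hC
  by_contra! hle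
  induction a using OnePoint.rec with
  | infty => exact haB ((infty_mem_openSet B).2 hB)
  | coe a =>
    have h2 : ‖a - B.center‖ ≤ B.radius := by simpa [mem_openSet_coe, hB] using haB
    have h3 : C.radius ≤ ‖a - C.center‖ := by simpa [mem_openSet_coe, hC] using haC
    have h4 : ‖a - C.center‖ ≤ B.radius := by
      have := norm_sub_le_of_le h2 h1.le
      simpa using this
    have h5 : B.radius ≤ ‖a - B.center‖ := by
      have h6 : ‖C.center - B.center‖ < ‖a - C.center‖ := by linarith
      have := norm_add_eq_of_lt h6
      rw [sub_add_sub_cancel] at this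
      linarith
    have h6 : (a : OnePoint K) ∈ B.closedSet := by simpa [mem_closedSet_coe, hB] using h5
    have h7 : (a : OnePoint K) ∈ C.closedSet := by
      simpa [mem_closedSet_coe, hC] using h4.trans hle
    exact Set.disjoint_left.1 hd h6 h7

theorem joinRadius_of_atInfinity {B C : Ball K} (hd : Disjoint B.closedSet C.closedSet)
    (hB : B.atInfinity) (hC : C.atInfinity = false) {a : OnePoint K} (haB : a ∉ B.openSet)
    (haC : a ∉ C.openSet) : joinRadius B C = B.radius := by
  have h1 := norm_center_sub_lt_radius hd hB hC
  have h2 := radius_lt_radius hd hB hC haB haC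
  rw [norm_sub_rev] at h1
  rw [joinRadius, max_eq_left h2.le, max_eq_left h1.le]

theorem ballRatio_lt_one {B C : Ball K} (hd : Disjoint B.closedSet C.closedSet)
    {a : OnePoint K} (haB : a ∉ B.openSet) (haC : a ∉ C.openSet) : ballRatio B C < 1 := by
  have hr := B.radius_pos
  have hs := C.radius_pos
  rw [ballRatio, div_lt_one (pow_pos (joinRadius_pos B C) 2), pow_two]
  cases hB : B.atInfinity with
  | true =>
    have hC := not_both_atInfinity hd hB
    have := radius_lt_radius hd hB hC haB haC
    rw [joinRadius_of_atInfinity hd hB hC haB haC]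
    gcongr
  | false =>
    cases hC : C.atInfinity with
    | true =>
      have := radius_lt_radius hd.symm hC hB haC haB
      rw [joinRadius_comm, joinRadius_of_atInfinity hd.symm hC hB haC haB]
      gcongr
    | false =>
      have h1 := radius_lt_norm_center_sub hd hB hC
      have h2 := radius_lt_norm_center_sub hd.symm hC hB
      rw [norm_sub_rev] at h2
      rw [joinRadius_of_finite hd hB hC]
      gcongr

theorem norm_crossDev_of_atInfinity {B C : Ball K} (hd : Disjoint B.closedSet C.closedSet)
    (hB : B.atInfinity) (hC : C.atInfinity = false) {a : OnePoint K} (haB : a ∉ B.openSet)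
    (haC : a ∉ C.openSet) {z w x y : OnePoint K}
    (hz : z ∈ B.closedSet) (hw : w ∈ B.closedSet) (hx : x ∈ C.closedSet) (hy : y ∈ C.closedSet) :
    ‖crossDev z w x y‖ = B.width z w * C.width x y * ballRatio B C := by
  have hr := B.radius_pos
  have hs := C.radius_pos
  have hcen := norm_center_sub_lt_radius hd hB hC
  have hrad := radius_lt_radius hd hB hC haB haC
  -- Seen from B, all points of C are as far away as the centre of B, so the denominator of the
  -- cross ratio does not depend on x, y.
  have key : ∀ u v : OnePoint K, u ∈ B.closedSet → v ∈ C.closedSet →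
      ‖diff u v‖ = ‖diff u B.center‖ := by
    intro u v hu hv
    induction v using OnePoint.rec with
    | infty => simp [infty_mem_closedSet, hC] at hv
    | coe v =>
      induction u using OnePoint.rec with
      | infty => simp
      | coe u =>
        have h1 : B.radius ≤ ‖u - B.center‖ := by simpa [mem_closedSet_coe, hB] using hu
        have h2 : ‖v - C.center‖ ≤ C.radius := by simpa [mem_closedSet_coe, hC] using hv
        have h3 : ‖v - B.center‖ < B.radius := by
          have := (IsUltrametricDist.norm_add_le_max (v - C.center) (C.center - B.center)).trans_lt
            (max_lt (h2.trans_lt hrad) hcen)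
          simpa using this
        have := norm_sub_eq_of_lt (h3.trans_le h1)
        simpa using this
  rw [crossDev, norm_div, norm_mul, norm_mul, key z y hz hy, key w x hw hx, Ball.width,
    Ball.width, if_pos hB, if_neg (by simp [hC]), ballRatio,
    joinRadius_of_atInfinity hd hB hC haB haC]
  field_simp

/-- For two points in each of two disjoint closed balls, the cross ratio deviates from `1` by the
product of the widths and of `p` to the power minus the distance of the balls. -/
theorem norm_crossDev_eq {B C : Ball K} (hd : Disjoint B.closedSet C.closedSet)
    {a : OnePoint K} (haB : a ∉ B.openSet)
    (haC : a ∉ C.openSet) {z w x y : OnePoint K}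
    (hz : z ∈ B.closedSet) (hw : w ∈ B.closedSet) (hx : x ∈ C.closedSet) (hy : y ∈ C.closedSet) :
    ‖crossDev z w x y‖ = B.width z w * C.width x y * ballRatio B C := by
  cases hB : B.atInfinity with
  | true =>
    exact norm_crossDev_of_atInfinity hd hB (not_both_atInfinity hd hB) haB haC hz hw hx hy
  | false =>
    cases hC : C.atInfinity with
    | true =>
      rw [norm_crossDev_comm, norm_crossDev_of_atInfinity hd.symm hC hB haC haB hx hy hz hw,
        ballRatio_comm, mul_comm (B.width z w)]
    | false =>
      have hr := B.radius_pos
      have hs := C.radius_pos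
      have h1 := radius_lt_norm_center_sub hd hB hC
      have h2 := radius_lt_norm_center_sub hd.symm hC hB
      rw [norm_sub_rev] at h2
      have key : ∀ u v : OnePoint K, u ∈ B.closedSet → v ∈ C.closedSet →
          ‖diff u v‖ = ‖B.center - C.center‖ := by
        intro u v hu hv
        induction v using OnePoint.rec with
        | infty => simp [infty_mem_closedSet, hC] at hv
        | coe v =>
          induction u using OnePoint.rec with
          | infty => simp [infty_mem_closedSet, hB] at hu
          | coe u =>
            have h3 : ‖u - B.center‖ ≤ B.radius := by simpa [mem_closedSet_coe, hB] using hu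
            have h4 : ‖v - C.center‖ ≤ C.radius := by simpa [mem_closedSet_coe, hC] using hv
            have h5 := norm_sub_lt_of_lt (h3.trans_lt h1) (h4.trans_lt h2)
            rw [← norm_add_eq_of_lt h5, diff_coe_coe]
            congr 1
            ring
      have hR : 0 < ‖B.center - C.center‖ := hr.trans h1
      rw [crossDev, norm_div, norm_mul, norm_mul, key z y hz hy, norm_diff_comm w x,
        norm_diff_comm x w, key w x hw hx, Ball.width, Ball.width, if_neg (by simp [hB]),
        if_neg (by simp [hC]), ballRatio, joinRadius_of_finite hd hB hC]
      field_simp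

end Separation

/-- The width of a pair of points is recovered from cross ratios with points outside the ball. -/
theorem Ball.width_le_of_forall_crossDev_le {K : Type*} [NontriviallyNormedField K]
    [IsUltrametricDist K] [IsAlgClosed K] (C : Ball K) {x y : OnePoint K} (hx : x ∈ C.closedSet)
    (hy : y ∈ C.closedSet) {M : ℝ}
    (h : ∀ z w, z ∉ C.openSet → w ∉ C.openSet → ‖crossDev z w x y‖ ≤ M) : C.width x y ≤ M := by
  have hs := C.radius_pos
  unfold Ball.width
  split_ifs with hC
  · set X := ‖diff x y‖ / (‖diff x C.center‖ * ‖diff y C.center‖) with hX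
    have hX0 : 0 ≤ X := by positivity
    -- The radius need not be a value of the norm, so test points at distances just below it are
    -- used and the limit is taken.
    have key : ∀ t, 0 < t → t < C.radius → t * X ≤ M := by
      intro t ht htC
      obtain ⟨u, hu1, hu2⟩ := exists_norm_between (K := K) ht htC
      have h1 := h C.center ((C.center + u : K) : OnePoint K)
        (by simp [mem_openSet_coe, hC, hs.le]) (by simp [mem_openSet_coe, hC, hu2.le])
      have h2 : ‖diff ((C.center + u : K) : OnePoint K) x‖ = ‖diff x C.center‖ := by
        induction x using OnePoint.rec with
        | infty => simp
        | coe x =>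
          have h3 : C.radius ≤ ‖x - C.center‖ := by simpa [mem_closedSet_coe, hC] using hx
          rw [norm_diff_comm, diff_coe_coe, diff_coe_coe,
            ← norm_sub_eq_of_lt (hu2.trans_le h3), sub_sub]
      rw [crossDev, norm_div, norm_mul, norm_mul, h2, norm_diff_comm C.center y, diff_coe_coe,
        sub_add_cancel_left, norm_neg] at h1
      calc t * X ≤ ‖u‖ * X := by gcongr
        _ ≤ M := by rw [hX, mul_div_assoc'] ; rwa [mul_comm ‖diff x _‖]
    rw [mul_div_assoc, ← hX]
    exact le_of_tendsto (((continuous_mul_const X).tendsto C.radius).mono_left nhdsWithin_le_nhds)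
      (Filter.mem_of_superset (Ioo_mem_nhdsLT hs) fun t ht => key t ht.1 ht.2)
  · have hC : C.atInfinity = false := by simpa using hC
    induction x using OnePoint.rec with
    | infty => simp [infty_mem_closedSet, hC] at hx
    | coe x =>
      have hx' : ‖x - C.center‖ ≤ C.radius := by simpa [mem_closedSet_coe, hC] using hx
      induction y using OnePoint.rec with
      | infty => simp [infty_mem_closedSet, hC] at hy
      | coe y =>
        -- Here the test pair is ∞ and a point just outside the closed ball.
        have key : ∀ t, C.radius < t → ‖x - y‖ ≤ M * t := by
          intro t ht
          obtain ⟨u, hu1, hu2⟩ := exists_norm_between (K := K) hs ht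
          have h1 := h OnePoint.infty ((C.center + u : K) : OnePoint K)
            (by simp [infty_mem_openSet, hC]) (by simp [mem_openSet_coe, hC, hu1.le])
          have h2 : ‖C.center + u - x‖ = ‖u‖ := by
            rw [← norm_sub_eq_of_lt (hx'.trans_lt hu1)]
            congr 1
            ring
          simp only [crossDev, diff_infty_coe, diff_coe_coe, one_mul, norm_div, h2] at h1
          have hM : 0 ≤ M := le_trans (by positivity) h1
          rw [div_le_iff₀ (hs.trans hu1)] at h1
          exact h1.trans (by gcongr)
        rw [diff_coe_coe, div_le_iff₀ hs]
        have hlim : Filter.Tendsto (fun t => M * t) (nhdsWithin C.radius (Set.Ioi C.radius))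
            (nhds (M * C.radius)) :=
          ((continuous_const_mul M).tendsto C.radius).mono_left nhdsWithin_le_nhds
        exact ge_of_tendsto hlim (Filter.mem_of_superset self_mem_nhdsWithin key)

/-! ### Ping-pong: reduced words contract widths. -/

section Words

variable {K : Type*} {g : ℕ}

/-- The inverse of a letter. -/
def invLetter (h : Fin g × Bool) : Fin g × Bool := (h.1, !h.2)

@[simp] theorem invLetter_invLetter (h : Fin g × Bool) : invLetter (invLetter h) = h := by
  simp [invLetter]

theorem ne_invLetter {h k : Fin g × Bool} (hk : h.1 = k.1 → h.2 = k.2) : invLetter h ≠ k := by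
  rintro rfl
  simp [invLetter] at hk

theorem invLetter_ne (h : Fin g × Bool) : invLetter h ≠ h := ne_invLetter fun _ => rfl

/-- The group element of a letter. -/
def letter {G : Type*} [Group G] (γ : Fin g → G) (h : Fin g × Bool) : G :=
  cond h.2 (γ h.1) (γ h.1)⁻¹

theorem letter_invLetter {G : Type*} [Group G] (γ : Fin g → G) (h : Fin g × Bool) :
    letter γ (invLetter h) = (letter γ h)⁻¹ := by
  obtain ⟨i, _ | _⟩ := h <;> simp [letter, invLetter]

/-- The group element of a word. -/
def wordProd {G : Type*} [Group G] (γ : Fin g → G) (L : List (Fin g × Bool)) : G :=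
  (L.map (letter γ)).prod

theorem lift_mk_eq_wordProd {G : Type*} [Group G] (γ : Fin g → G) (L : List (Fin g × Bool)) :
    FreeGroup.lift γ (FreeGroup.mk L) = wordProd γ L := FreeGroup.lift_mk

@[simp] theorem wordProd_nil {G : Type*} [Group G] (γ : Fin g → G) : wordProd γ [] = 1 := rfl

@[simp] theorem wordProd_cons {G : Type*} [Group G] (γ : Fin g → G) (h : Fin g × Bool)
    (L : List (Fin g × Bool)) : wordProd γ (h :: L) = letter γ h * wordProd γ L := by
  simp [wordProd]

theorem wordProd_append {G : Type*} [Group G] (γ : Fin g → G) (L M : List (Fin g × Bool)) :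
    wordProd γ (L ++ M) = wordProd γ L * wordProd γ M := by
  simp [wordProd]

/-- The balls `D h`, indexed by the letters, are in ping-pong position for `γ`: the letter `h` maps
the complement of the open ball of `h⁻¹` into the closed ball of `h`, and the balls are separated,
with ratios at most `q`. The point `o` lies in the fundamental domain. -/
structure IsPingPong [NormedField K] (γ : Fin g → PGL(2, K)) (D : Fin g × Bool → Ball K)
    (o : OnePoint K) (q : ℝ) : Prop where
  q_pos : 0 < q
  q_lt_one : q < 1
  disjoint : Pairwise fun h k => Disjoint (D h).closedSet (D k).closedSet
  smul_mem : ∀ h x, x ∉ (D (invLetter h)).openSet → letter γ h • x ∈ (D h).closedSet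
  base : ∀ h, o ∉ (D h).openSet
  ratio_le : ∀ h k, h ≠ k → ballRatio (D h) (D k) ≤ q

namespace IsPingPong

variable [NontriviallyNormedField K]
  {γ : Fin g → PGL(2, K)} {D : Fin g × Bool → Ball K} {o : OnePoint K} {q : ℝ}

theorem notMem_openSet (P : IsPingPong γ D o q) {h k : Fin g × Bool} (hk : h ≠ k) {x : OnePoint K}
    (hx : x ∈ (D h).closedSet) : x ∉ (D k).openSet :=
  fun hx' => Set.disjoint_left.1 (P.disjoint hk) hx ((D k).openSet_subset_closedSet hx')

theorem inv_smul_mem (P : IsPingPong γ D o q) (h : Fin g × Bool) {x : OnePoint K}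
    (hx : x ∉ (D h).openSet) : (letter γ h)⁻¹ • x ∈ (D (invLetter h)).closedSet := by
  rw [← letter_invLetter]
  exact P.smul_mem _ _ (by rwa [invLetter_invLetter])

/-- The tail moves x into the ball of its own first letter, which is not h⁻¹ as the word is reduced;
so h can be applied next. Only the last letter restricts x. -/
theorem wordProd_smul_mem (P : IsPingPong γ D o q) {x : OnePoint K} :
    ∀ (h : Fin g × Bool) (L : List (Fin g × Bool)), FreeGroup.IsReduced (h :: L) →
      x ∉ (D (invLetter ((h :: L).getLast (List.cons_ne_nil h L)))).openSet →
      wordProd γ (h :: L) • x ∈ (D h).closedSet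
  | h, [], _, hx => by simpa using P.smul_mem h x hx
  | h, k :: L, hL, hx => by
    rw [FreeGroup.isReduced_cons_cons] at hL
    rw [wordProd_cons, mul_smul]
    refine P.smul_mem _ _ (P.notMem_openSet (ne_invLetter hL.1).symm ?_)
    exact P.wordProd_smul_mem k L hL.2 (by rwa [List.getLast_cons (List.cons_ne_nil k L)] at hx)

theorem wordProd_inv_smul_mem (P : IsPingPong γ D o q) :
    ∀ (h : Fin g × Bool) (L : List (Fin g × Bool)), FreeGroup.IsReduced (h :: L) →
      ∀ {z : OnePoint K}, z ∉ (D h).openSet → (wordProd γ (h :: L))⁻¹ • z ∈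
        (D (invLetter ((h :: L).getLast (List.cons_ne_nil h L)))).closedSet
  | h, [], _, z, hz => by simpa using P.inv_smul_mem h hz
  | h, k :: L, hL, z, hz => by
    rw [FreeGroup.isReduced_cons_cons] at hL
    rw [List.getLast_cons (List.cons_ne_nil k L), wordProd_cons, mul_inv_rev, mul_smul]
    exact P.wordProd_inv_smul_mem k L hL.2
      (P.notMem_openSet (ne_invLetter hL.1) (P.inv_smul_mem h hz))

/-- A non-empty word moves no point of the boundary of the ball of `k` to a point of the boundary
of the ball of `l`, unless `k = l⁻¹`. -/
theorem wordProd_smul_ne (P : IsPingPong γ D o q) {x z : OnePoint K} {k l : Fin g × Bool}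
    (hx : x ∈ (D k).closedSet \ (D k).openSet) (hz : z ∈ (D l).closedSet \ (D l).openSet)
    (hkl : k ≠ invLetter l) {L : List (Fin g × Bool)} (hL : FreeGroup.IsReduced L)
    (hL0 : L ≠ []) : wordProd γ L • x ≠ z := by
  have hF : ∀ {k : Fin g × Bool} {x : OnePoint K}, x ∈ (D k).closedSet \ (D k).openSet →
      ∀ h, x ∉ (D h).openSet := by
    intro k x hx h
    by_cases e : k = h
    · exact e ▸ hx.2
    · exact P.notMem_openSet e hx.1
  obtain _ | ⟨h, L⟩ := L
  · exact absurd rfl hL0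
  rintro rfl
  have h1 := P.wordProd_smul_mem h L hL (hF hx _)
  -- The image lies in the ball of the first letter, which must be that of z. Cancelling this letter
  -- puts the remaining image into the ball of l⁻¹, against reducedness or `hkl`.
  have hhl : h = l := by
    by_contra e
    exact Set.disjoint_left.1 (P.disjoint e) h1 hz.1
  subst hhl
  have h2 := P.inv_smul_mem h hz.2
  rw [wordProd_cons, mul_smul, inv_smul_smul] at h2
  obtain _ | ⟨k', L⟩ := L
  · rw [wordProd_nil, one_smul] at h2
    exact Set.disjoint_left.1 (P.disjoint hkl) hx.1 h2
  · rw [FreeGroup.isReduced_cons_cons] at hL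
    exact Set.disjoint_left.1 (P.disjoint (ne_invLetter hL.1)) h2
      (P.wordProd_smul_mem k' L hL.2 (hF hx _))

variable [IsUltrametricDist K]

theorem norm_crossDev_eq (P : IsPingPong γ D o q) {h k : Fin g × Bool} (hk : h ≠ k)
    {z w x y : OnePoint K} (hz : z ∈ (D h).closedSet) (hw : w ∈ (D h).closedSet)
    (hx : x ∈ (D k).closedSet) (hy : y ∈ (D k).closedSet) :
    ‖crossDev z w x y‖ = (D h).width z w * (D k).width x y * ballRatio (D h) (D k) :=
  MumfordCurve.norm_crossDev_eq (P.disjoint hk) (P.base h) (P.base k) hz hw hx hy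

theorem norm_crossDev_le (P : IsPingPong γ D o q) {h k : Fin g × Bool} (hk : h ≠ k)
    {z w x y : OnePoint K} (hz : z ∈ (D h).closedSet) (hw : w ∈ (D h).closedSet)
    (hx : x ∈ (D k).closedSet) (hy : y ∈ (D k).closedSet) :
    ‖crossDev z w x y‖ ≤ q * (D k).width x y := by
  rw [P.norm_crossDev_eq hk hz hw hx hy]
  have h1 := (D h).width_le_one hz hw
  have h2 := P.ratio_le h k hk
  have h3 := (D k).width_nonneg x y
  have h4 := (ballRatio_pos (D h) (D k)).le
  calc _ ≤ 1 * (D k).width x y * q := by gcongr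
    _ = _ := by ring

variable [IsAlgClosed K]

/-- Applying a letter contracts widths. -/
theorem width_smul_le (P : IsPingPong γ D o q) {h k : Fin g × Bool} (hk : invLetter h ≠ k)
    {x y : OnePoint K} (hx : x ∈ (D k).closedSet) (hy : y ∈ (D k).closedSet) :
    (D h).width (letter γ h • x) (letter γ h • y) ≤ q * (D k).width x y := by
  refine (D h).width_le_of_forall_crossDev_le
    (P.smul_mem _ _ (P.notMem_openSet hk.symm hx)) (P.smul_mem _ _ (P.notMem_openSet hk.symm hy))
    fun z w hz hw => ?_
  -- Moved to the other pair, the letter takes points outside the ball of h into the ball of h⁻¹,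
  -- which is separated from that of k.
  rw [← crossDev_smul (letter γ h)⁻¹, inv_smul_smul, inv_smul_smul]
  exact P.norm_crossDev_le hk (P.inv_smul_mem h hz) (P.inv_smul_mem h hw) hx hy

/-- The letter applied first only gives width at most 1; each later one gives a factor q. Hence the
exponent is one less than the word length. -/
theorem width_wordProd_smul_le (P : IsPingPong γ D o q) {x y : OnePoint K} :
    ∀ (h : Fin g × Bool) (L : List (Fin g × Bool)), FreeGroup.IsReduced (h :: L) →
      x ∉ (D (invLetter ((h :: L).getLast (List.cons_ne_nil h L)))).openSet →
      y ∉ (D (invLetter ((h :: L).getLast (List.cons_ne_nil h L)))).openSet →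
      (D h).width (wordProd γ (h :: L) • x) (wordProd γ (h :: L) • y) ≤ q ^ L.length
  | h, [], _, hx, hy => by
    simpa using (D h).width_le_one (P.smul_mem h x hx) (P.smul_mem h y hy)
  | h, k :: L, hL, hx, hy => by
    rw [FreeGroup.isReduced_cons_cons] at hL
    rw [List.getLast_cons (List.cons_ne_nil k L)] at hx hy
    rw [wordProd_cons, mul_smul, mul_smul]
    refine (P.width_smul_le (ne_invLetter hL.1) (P.wordProd_smul_mem k L hL.2 hx)
      (P.wordProd_smul_mem k L hL.2 hy)).trans ?_
    rw [List.length_cons, pow_succ']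
    exact mul_le_mul_of_nonneg_left (P.width_wordProd_smul_le k L hL.2 hx hy) P.q_pos.le

/-- The missing factor q comes from the separation of the balls of h and k. -/
theorem norm_crossDev_wordProd_smul_le (P : IsPingPong γ D o q) {z w x y : OnePoint K}
    {h k : Fin g × Bool} (hk : h ≠ k) {L : List (Fin g × Bool)} (hL : FreeGroup.IsReduced (k :: L))
    (hz : z ∈ (D h).closedSet) (hw : w ∈ (D h).closedSet)
    (hx : ∀ l, x ∉ (D l).openSet) (hy : ∀ l, y ∉ (D l).openSet) :
    ‖crossDev z w (wordProd γ (k :: L) • x) (wordProd γ (k :: L) • y)‖ ≤ q ^ (k :: L).length := by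
  refine (P.norm_crossDev_le hk hz hw (P.wordProd_smul_mem k L hL (hx _))
    (P.wordProd_smul_mem k L hL (hy _))).trans ?_
  rw [List.length_cons, pow_succ']
  exact mul_le_mul_of_nonneg_left (P.width_wordProd_smul_le k L hL (hx _) (hy _)) P.q_pos.le

/-- The cross ratio of two points of the fundamental domain with a translate of two such points
tends to `1` with the length of the translating word. -/
theorem norm_crossDev_le_pow (P : IsPingPong γ D o q) {z w x y : OnePoint K} {m : ℕ} (hm : 1 ≤ m)
    {L : List (Fin g × Bool)} (hL : FreeGroup.IsReduced L) (hlen : m < L.length)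
    (hz : ∀ l, z ∉ (D l).openSet) (hw : ∀ l, w ∉ (D l).openSet)
    (hx : ∀ l, x ∉ (D l).openSet) (hy : ∀ l, y ∉ (D l).openSet) :
    ‖crossDev z w (wordProd γ L • x) (wordProd γ L • y)‖ ≤ q ^ m := by
  obtain _ | ⟨h, _ | ⟨k, L⟩⟩ := L
  · simp at hlen
  · simp at hlen; omega
  · rw [FreeGroup.isReduced_cons_cons] at hL
    -- The points z, w need not share a ball; h⁻¹ moves both into the ball of h⁻¹. This costs one
    -- letter, which m < length pays for.
    rw [wordProd_cons, mul_smul, mul_smul, ← crossDev_smul (letter γ h)⁻¹, inv_smul_smul,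
      inv_smul_smul]
    refine (P.norm_crossDev_wordProd_smul_le (ne_invLetter hL.1) hL.2
      (P.inv_smul_mem h (hz _)) (P.inv_smul_mem h (hw _)) hx hy).trans ?_
    refine pow_le_pow_of_le_one P.q_pos.le P.q_lt_one.le ?_
    simp only [List.length_cons] at hlen ⊢
    omega

end IsPingPong

end Words

/-! ### Infinite products in an ultrametric field. -/

section Products

variable {K β : Type*} [NormedField K] [IsUltrametricDist K]

theorem norm_eq_one_of_norm_sub_one_lt {x : K} (h : ‖x - 1‖ < 1) : ‖x‖ = 1 := by
  have h' : ‖x - 1‖ < ‖(1 : K)‖ := by rwa [norm_one]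
  simpa using norm_add_eq_of_lt h'

theorem norm_inv_sub_one {x : K} (h : ‖x - 1‖ < 1) : ‖x⁻¹ - 1‖ = ‖x - 1‖ := by
  have h1 := norm_eq_one_of_norm_sub_one_lt h
  have h0 : x ≠ 0 := norm_ne_zero_iff.1 (by rw [h1]; exact one_ne_zero)
  have : x⁻¹ - 1 = -(x - 1) * x⁻¹ := by field_simp; ring
  rw [this, norm_mul, norm_neg, norm_inv, h1, inv_one, mul_one]

theorem norm_prod_sub_one_le {f : β → K} {ε : ℝ} (hε : 0 ≤ ε) (hε1 : ε < 1) (s : Finset β)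
    (h : ∀ i ∈ s, ‖f i - 1‖ ≤ ε) : ‖∏ i ∈ s, f i - 1‖ ≤ ε := by
  classical
  induction s using Finset.induction_on with
  | empty => simpa using hε
  | insert i s hi ih =>
    have h1 := h i (Finset.mem_insert_self _ _)
    have h2 := ih fun k hk => h k (Finset.mem_insert_of_mem hk)
    rw [Finset.prod_insert hi]
    have h3 : f i * ∏ k ∈ s, f k - 1 = f i * (∏ k ∈ s, f k - 1) + (f i - 1) := by ring
    rw [h3]
    refine (IsUltrametricDist.norm_add_le_max _ _).trans (max_le ?_ h1)
    rwa [norm_mul, norm_eq_one_of_norm_sub_one_lt (h1.trans_lt hε1), one_mul]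

/-- In a complete non-Archimedean field, a product of non-zero factors that tend to `1` converges
unconditionally to a non-zero limit. -/
theorem exists_hasProd_ne_zero [CompleteSpace K] {f : β → K} (hf : ∀ i, f i ≠ 0)
    (h : ∀ ε : ℝ, 0 < ε → ∃ s : Finset β, ∀ i ∉ s, ‖f i - 1‖ ≤ ε) :
    ∃ a, a ≠ 0 ∧ HasProd f a := by
  classical
  obtain ⟨s₀, hs₀⟩ := h (1 / 2) (by norm_num)
  set c := ‖∏ i ∈ s₀, f i‖ with hc
  have hc0 : 0 < c := norm_pos_iff.2 (Finset.prod_ne_zero_iff.2 fun i _ => hf i)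
  -- Factors closer than 1 to 1 have norm 1, so the norm of the partial products stabilises. This
  -- makes the limit non-zero and turns relative errors into absolute ones.
  have hnorm : ∀ t, s₀ ⊆ t → ‖∏ i ∈ t, f i‖ = c := by
    intro t ht
    have h1 : ‖∏ i ∈ t \ s₀, f i - 1‖ ≤ 1 / 2 := norm_prod_sub_one_le (by norm_num) (by norm_num)
      _ fun i hi => hs₀ i (Finset.mem_sdiff.1 hi).2
    rw [← Finset.prod_sdiff ht, norm_mul,
      norm_eq_one_of_norm_sub_one_lt (h1.trans_lt (by norm_num)), one_mul]
  have hcauchy : CauchySeq fun s : Finset β => ∏ i ∈ s, f i := by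
    refine Metric.cauchySeq_iff'.2 fun ε hε => ?_
    set η := min (1 / 2) (ε / (2 * c)) with hη
    have hη0 : 0 < η := by positivity
    have hη1 : η < 1 := (min_le_left _ _).trans_lt (by norm_num)
    obtain ⟨s₁, hs₁⟩ := h η hη0
    refine ⟨s₀ ∪ s₁, fun t ht => ?_⟩
    have h1 : ‖∏ i ∈ t \ (s₀ ∪ s₁), f i - 1‖ ≤ η := norm_prod_sub_one_le hη0.le hη1 _
      fun i hi => hs₁ i fun hi' =>
        (Finset.mem_sdiff.1 hi).2 (Finset.mem_union_right _ hi')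
    rw [dist_eq_norm, ← Finset.prod_sdiff ht, ← sub_one_mul, norm_mul,
      hnorm _ Finset.subset_union_left]
    calc _ ≤ ε / (2 * c) * c := by gcongr; exact h1.trans (min_le_right _ _)
      _ = ε / 2 := by field_simp
      _ < ε := by linarith
  obtain ⟨a, ha⟩ := cauchySeq_tendsto_of_complete hcauchy
  refine ⟨a, ?_, by simpa [HasProd] using ha⟩
  have h1 : ‖a‖ = c := tendsto_nhds_unique ha.norm
    (tendsto_const_nhds.congr' ((Filter.eventually_ge_atTop s₀).mono fun t ht => (hnorm t ht).symm))
  exact norm_ne_zero_iff.1 (by rw [h1]; exact hc0.ne')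

theorem norm_prod_div_sub_one_le {f : β → K} (hf : ∀ i, f i ≠ 0) {a : K} (ha : a ≠ 0)
    (h : HasProd f a) {ε : ℝ} (hε : 0 ≤ ε) (hε1 : ε < 1) (s : Finset β)
    (hs : ∀ i ∉ s, ‖f i - 1‖ ≤ ε) : ‖(∏ i ∈ s, f i) / a - 1‖ ≤ ε := by
  classical
  have h' : Filter.Tendsto (fun t : Finset β => ∏ i ∈ t, f i) Filter.atTop (nhds a) := by
    simpa [HasProd] using h
  refine le_of_tendsto (((tendsto_const_nhds.div h' ha).sub_const 1).norm)
    ((Filter.eventually_ge_atTop s).mono fun t ht => ?_)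
  have h0 : ∏ i ∈ s, f i ≠ 0 := Finset.prod_ne_zero_iff.2 fun i _ => hf i
  have h1 : ‖∏ i ∈ t \ s, f i - 1‖ ≤ ε := norm_prod_sub_one_le hε hε1 _
    fun i hi => hs i (Finset.mem_sdiff.1 hi).2
  have h2 : (∏ i ∈ s, f i) / ∏ i ∈ t, f i = (∏ i ∈ t \ s, f i)⁻¹ := by
    rw [← Finset.prod_sdiff ht, mul_comm, div_mul_cancel_left₀ h0]
  rw [Pi.div_apply, h2, norm_inv_sub_one (h1.trans_lt hε1)]
  exact h1

end Products

/-! ### Convergence of the separate theta products when ∞ is not a bad point. -/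

section Infinity

variable {K : Type*} [NontriviallyNormedField K] [IsUltrametricDist K] {g : ℕ}

namespace IsPingPong

variable [IsAlgClosed K] {γ : Fin g → PGL(2, K)} {D : Fin g × Bool → Ball K} {o : OnePoint K}
  {q : ℝ}

/-- If both fixed points were in the open ball of h⁻¹, the inverse letter would contract their width
while fixing them, so they would coincide. -/
theorem exists_fixed_mem_closedSet (P : IsPingPong γ D o q) {h : Fin g × Bool}
    (hh : IsHyperbolic (letter γ h)) :
    ∃ x ∈ (D h).closedSet, letter γ h • x = x := by
  obtain ⟨x, y, hxy, hx, hy⟩ := hh.exists_fixed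
  by_cases h1 : x ∈ (D (invLetter h)).openSet
  · by_cases h2 : y ∈ (D (invLetter h)).openSet
    · have h1' := (D _).openSet_subset_closedSet h1
      have h2' := (D _).openSet_subset_closedSet h2
      have h3 : invLetter (invLetter h) ≠ invLetter h := invLetter_ne _
      have h4 := P.width_smul_le h3 h1' h2'
      rw [letter_invLetter, inv_smul_eq_iff.2 hx.symm, inv_smul_eq_iff.2 hy.symm] at h4
      have h5 := (D (invLetter h)).width_nonneg x y
      have h6 := P.q_lt_one
      exact absurd ((D _).eq_of_width_eq_zero h1' h2' (by nlinarith)) hxy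
    · exact ⟨y, hy ▸ P.smul_mem h y h2, hy⟩
  · exact ⟨x, hx ▸ P.smul_mem h x h1, hx⟩

/-- If `∞` is not a bad point, it is not contained in the translates of the closed balls by long
words. -/
theorem exists_inv_smul_infty_mem (P : IsPingPong γ D o q) {Γ : Subgroup PGL(2, K)}
    (hΓ : ∀ L, wordProd γ L ∈ Γ) (h1 : ∀ h, letter γ h ≠ 1)
    (hhyp : ∀ h, IsHyperbolic (letter γ h)) (hinf : OnePoint.infty ∉ badPts Γ) :
    ∃ N : ℕ, ∀ (h : Fin g × Bool) (L : List (Fin g × Bool)), FreeGroup.IsReduced (h :: L) →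
      N ≤ L.length → (wordProd γ (h :: L))⁻¹ • (OnePoint.infty : OnePoint K) ∈
        (D (invLetter ((h :: L).getLast (List.cons_ne_nil h L)))).openSet := by
  obtain ⟨U, hU, hUfix⟩ : ∃ U : Ball K, OnePoint.infty ∈ U.openSet ∧
      ¬(U.openSet ∩ fixedPts Γ).Nonempty := by
    simpa [badPts] using hinf
  have hUinf := (infty_mem_openSet U).1 hU
  have hUr := U.radius_pos
  have hρ : ∀ h, 0 < max U.radius ‖U.center - (D h).center‖ := fun h => lt_max_of_lt_left hUr
  -- A point outside U has distance at most this maximum from the centre of the ball of h. So if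
  -- that ball contains ∞ and the point, their width is greater than q ^ `n h`.
  choose n hn using fun h : Fin g × Bool =>
    exists_pow_lt_of_lt_one (div_pos (D h).radius_pos (hρ h)) P.q_lt_one
  refine ⟨Finset.univ.sup n, fun h L hL hlen => ?_⟩
  by_contra hx
  set w := wordProd γ (h :: L) with hw
  set k := (h :: L).getLast (List.cons_ne_nil h L) with hk
  obtain ⟨y, hy, hfix⟩ := P.exists_fixed_mem_closedSet (hhyp k)
  have hy' : y ∉ (D (invLetter k)).openSet := P.notMem_openSet (invLetter_ne k).symm hy
  have h2 := P.width_wordProd_smul_le h L hL hx hy'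
  have h3 := P.wordProd_smul_mem h L hL hx
  have h4 := P.wordProd_smul_mem h L hL hy'
  rw [← hw, smul_inv_smul] at h2 h3
  rw [← hw] at h4
  rw [infty_mem_closedSet] at h3
  -- A conjugate of the last letter fixes w • y. The word makes its width with ∞ small, which forces
  -- it into U.
  have hYfix : w • y ∈ fixedPts Γ := by
    refine ⟨w * letter γ k * w⁻¹, ?_, ?_, ?_⟩
    · have := hΓ [k]
      rw [wordProd_cons, wordProd_nil, mul_one] at this
      exact Γ.mul_mem (Γ.mul_mem (hΓ _) this) (Γ.inv_mem (hΓ _))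
    · exact fun e => h1 k (conj_eq_one_iff.1 e)
    · rw [mul_smul, mul_smul, inv_smul_smul, hfix]
  have hYU : w • y ∉ U.openSet := fun hY => hUfix ⟨_, hY, hYfix⟩
  generalize w • y = Y at *
  induction Y using OnePoint.rec with
  | infty => exact hYU hU
  | coe t =>
    have h5 : ‖t - U.center‖ ≤ U.radius := by simpa [mem_openSet_coe, hUinf] using hYU
    have h6 : (D h).radius ≤ ‖t - (D h).center‖ := by simpa [mem_closedSet_coe, h3] using h4
    have h7 : ‖t - (D h).center‖ ≤ max U.radius ‖U.center - (D h).center‖ := by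
      have := (IsUltrametricDist.norm_add_le_max (t - U.center) (U.center - (D h).center)).trans
        (max_le_max_right _ h5)
      simpa using this
    have h8 : (D h).radius / ‖t - (D h).center‖ ≤ q ^ L.length := by
      simpa [Ball.width, h3] using h2
    have h9 : q ^ L.length ≤ q ^ n h := pow_le_pow_of_le_one P.q_pos.le P.q_lt_one.le
      ((Finset.le_sup (Finset.mem_univ h)).trans hlen)
    have h10 : (D h).radius / max U.radius ‖U.center - (D h).center‖ ≤
        (D h).radius / ‖t - (D h).center‖ :=
      div_le_div_of_nonneg_left (D h).radius_pos.le ((D h).radius_pos.trans_le h6) h7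
    exact absurd (hn h) (not_lt.2 (h10.trans (h8.trans h9)))

/-- If `∞` is not a bad point, the factors of the theta function tend to `1` with the length of the
word. -/
theorem norm_factor_sub_one_le {N : ℕ} (P : IsPingPong γ D o q)
    (hN : ∀ (h : Fin g × Bool) (L : List (Fin g × Bool)), FreeGroup.IsReduced (h :: L) →
      N ≤ L.length → (wordProd γ (h :: L))⁻¹ • (OnePoint.infty : OnePoint K) ∈
        (D (invLetter ((h :: L).getLast (List.cons_ne_nil h L)))).openSet)
    {z x y : OnePoint K} (hz : ∀ l, z ∉ (D l).openSet) (hx : ∀ l, x ∉ (D l).openSet)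
    (hy : ∀ l, y ∉ (D l).openSet) (m : ℕ) {L : List (Fin g × Bool)} (hL : FreeGroup.IsReduced L)
    (hlen : N + 1 + m < L.length) (hzy : z ≠ wordProd γ L • y) :
    ‖factor (wordProd γ L • x) (wordProd γ L • y) z - 1‖ ≤ q ^ m := by
  -- The inverse of the prefix U takes both z and ∞ into the ball of the inverse of its last letter;
  -- V has more than m letters left for the contraction.
  obtain ⟨U, V, rfl, hU⟩ : ∃ U V, L = U ++ V ∧ U.length = N + 1 :=
    ⟨L.take (N + 1), L.drop (N + 1), (List.take_append_drop _ _).symm, by simp; omega⟩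
  obtain _ | ⟨h, U⟩ := U
  · simp at hU
  obtain _ | ⟨k, V⟩ := V
  · simp at hlen hU; omega
  rw [List.length_append, hU] at hlen
  obtain ⟨hU1, hV1, hUV⟩ := List.isChain_append.1 hL
  set l := (h :: U).getLast (List.cons_ne_nil h U) with hl
  have hlk : l.1 = k.1 → l.2 = k.2 := hUV l (List.getLast_mem_getLast? _) k (by simp)
  have hinf := hN h U hU1 (by simp at hU; omega)
  set u := wordProd γ (h :: U) with hu
  have hVmem : ∀ s : OnePoint K, (∀ l, s ∉ (D l).openSet) →
      wordProd γ (k :: V) • s ∈ (D k).closedSet := fun s hs => P.wordProd_smul_mem k V hV1 (hs _)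
  have hne : ∀ s : OnePoint K, (∀ l, s ∉ (D l).openSet) →
      wordProd γ (h :: U ++ k :: V) • s ≠ OnePoint.infty := by
    intro s hs e
    rw [wordProd_append, mul_smul, ← eq_inv_smul_iff] at e
    exact P.notMem_openSet (ne_invLetter hlk).symm (hVmem s hs) (e ▸ hinf)
  obtain ⟨x', hx'⟩ := OnePoint.ne_infty_iff_exists.1 (hne x hx)
  obtain ⟨y', hy'⟩ := OnePoint.ne_infty_iff_exists.1 (hne y hy)
  rw [← hy'] at hzy
  rw [← hx', ← hy', factor_sub_one hzy, hx', hy', wordProd_append, mul_smul, mul_smul,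
    ← crossDev_smul u⁻¹, ← hu, inv_smul_smul, inv_smul_smul]
  refine (P.norm_crossDev_wordProd_smul_le (ne_invLetter hlk) hV1
    (P.wordProd_inv_smul_mem h U hU1 (hz h)) ((D _).openSet_subset_closedSet hinf) hx hy).trans ?_
  exact pow_le_pow_of_le_one P.q_pos.le P.q_lt_one.le (by omega)

end IsPingPong

end Infinity

/-! ### From a good fundamental domain to ping-pong. -/

section GoodPosition

variable {K : Type*} [NontriviallyNormedField K] {g : ℕ}

/-- The ball of a letter: `B i` for `γ i` and `B' i` for `(γ i)⁻¹`. -/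
def letterBall (B B' : Fin g → Ball K) (h : Fin g × Bool) : Ball K :=
  allBalls B B' (cond h.2 (Sum.inl h.1) (Sum.inr h.1))

theorem sum_of_letter_injective :
    Function.Injective fun h : Fin g × Bool =>
      (cond h.2 (Sum.inl h.1) (Sum.inr h.1) : Fin g ⊕ Fin g) := by
  rintro ⟨i, _ | _⟩ ⟨j, _ | _⟩ h <;> simp_all

variable {γ : Fin g → PGL(2, K)} {B B' : Fin g → Ball K}

theorem IsGoodFundamentalDomain.letterBall_disjoint (hF : IsGoodFundamentalDomain γ B B') :
    Pairwise fun h k =>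
      Disjoint (letterBall B B' h).closedSet (letterBall B B' k).closedSet :=
  fun _ _ hne => hF.disjoint (sum_of_letter_injective.ne hne)

theorem IsGoodFundamentalDomain.notMem_letterBall (hF : IsGoodFundamentalDomain γ B B')
    {k : Fin g × Bool} {x : OnePoint K}
    (hx : x ∈ (letterBall B B' k).closedSet \ (letterBall B B' k).openSet) (h : Fin g × Bool) :
    x ∉ (letterBall B B' h).openSet := by
  by_cases e : k = h
  · exact e ▸ hx.2
  · exact fun hx' => Set.disjoint_left.1 (hF.letterBall_disjoint e) hx.1
      (Ball.openSet_subset_closedSet _ hx')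

theorem IsGoodFundamentalDomain.smul_mem_boundary (hF : IsGoodFundamentalDomain γ B B') {i : Fin g}
    {x : OnePoint K} (hx : x ∈ (B' i).closedSet \ (B' i).openSet) :
    γ i • x ∈ (B i).closedSet \ (B i).openSet := by
  refine ⟨hF.image i ▸ ⟨x, hx.2, rfl⟩, ?_⟩
  have h := hx.1
  rw [← hF.image_inv i] at h
  obtain ⟨y, hy, rfl⟩ := h
  simpa using hy

variable [IsUltrametricDist K]

theorem IsGoodFundamentalDomain.isPingPong (hF : IsGoodFundamentalDomain γ B B') {p : ℝ}
    (hp : 1 < p) (i : Fin g) {a : OnePoint K}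
    (ha : ∀ h, a ∉ (letterBall B B' h).openSet) :
    IsPingPong γ (letterBall B B') a (p ^ (-minDist p B B')) := by
  have ha' : ∀ k, a ∉ (allBalls B B' k).openSet := by
    rintro (j | j)
    · exact ha (j, true)
    · exact ha (j, false)
  refine ⟨Real.rpow_pos_of_pos (by linarith) _, ?_, hF.letterBall_disjoint, ?_, ha, ?_⟩
  -- An index i provides a pair of distinct balls, so the infimum is an attained minimum and not the
  -- default value 0.
  · have : Nonempty {q : (Fin g ⊕ Fin g) × (Fin g ⊕ Fin g) // q.1 ≠ q.2} :=
      ⟨⟨(Sum.inl i, Sum.inr i), by simp⟩⟩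
    obtain ⟨k, hk⟩ := exists_eq_ciInf_of_finite (f := fun q : {q : (Fin g ⊕ Fin g) × (Fin g ⊕ Fin g)
      // q.1 ≠ q.2} => pointDist p (allBalls B B' q.1.1) (allBalls B B' q.1.2))
    rw [minDist, ← hk, rpow_neg_pointDist hp]
    exact ballRatio_lt_one (hF.disjoint k.2) (ha' _) (ha' _)
  · rintro ⟨j, _ | _⟩ x hx
    · have h : (γ j)⁻¹ • x ∈ (B' j).closedSet := hF.image_inv j ▸ ⟨x, hx, rfl⟩
      exact h
    · have h : γ j • x ∈ (B j).closedSet := hF.image j ▸ ⟨x, hx, rfl⟩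
      exact h
  · intro h k hne
    rw [← rpow_neg_pointDist hp]
    refine Real.rpow_le_rpow_of_exponent_le hp.le (neg_le_neg ?_)
    exact ciInf_le (Set.finite_range _).bddBelow (⟨(_, _), sum_of_letter_injective.ne hne⟩ :
      {q : (Fin g ⊕ Fin g) × (Fin g ⊕ Fin g) // q.1 ≠ q.2})

end GoodPosition

/-! ### Elements of Γ as reduced words. -/

section WordBall

variable {G : Type*} [Group G] {g : ℕ} {γ : Fin g → G} {Γ : Subgroup G}

theorem wordProd_mem (hgen : Subgroup.closure (Set.range γ) = Γ) (L : List (Fin g × Bool)) :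
    wordProd γ L ∈ Γ := by
  rw [← lift_mk_eq_wordProd, ← hgen, ← FreeGroup.range_lift_eq_closure]
  exact ⟨_, rfl⟩

theorem exists_reduced_wordProd_eq (hgen : Subgroup.closure (Set.range γ) = Γ) {δ : G}
    (hδ : δ ∈ Γ) : ∃ L, FreeGroup.IsReduced L ∧ wordProd γ L = δ := by
  rw [← hgen, ← FreeGroup.range_lift_eq_closure] at hδ
  obtain ⟨x, rfl⟩ := hδ
  exact ⟨x.toWord, FreeGroup.isReduced_toWord, by
    rw [← lift_mk_eq_wordProd, FreeGroup.mk_toWord]⟩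

theorem wordBall_subset (hgen : Subgroup.closure (Set.range γ) = Γ) (m : ℕ) :
    wordBall γ m ⊆ Γ := by
  rintro _ ⟨L, -, -, rfl⟩
  rw [lift_mk_eq_wordProd]
  exact wordProd_mem hgen L

theorem letter_ne_one (hfree : Function.Injective (FreeGroup.lift γ)) (h : Fin g × Bool) :
    letter γ h ≠ 1 := by
  intro e
  have h1 : FreeGroup.lift γ (FreeGroup.of h.1) = 1 := by
    obtain ⟨i, _ | _⟩ := h <;> simpa [letter] using e
  exact FreeGroup.of_ne_one h.1 (hfree (h1.trans (map_one _).symm))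

open Classical in
/-- The finite set of elements of `Γ` of word length at most `m`. -/
def wordBallFinset (γ : Fin g → G) (Γ : Subgroup G) (m : ℕ) : Finset Γ :=
  (wordBall_finite γ m).toFinset.subtype (· ∈ Γ)

theorem prod_wordBallFinset {M : Type*} [CommMonoid M]
    (hgen : Subgroup.closure (Set.range γ) = Γ) (m : ℕ) (f : G → M) :
    ∏ δ ∈ wordBallFinset γ Γ m, f δ = ∏ δ ∈ (wordBall_finite γ m).toFinset, f δ := by
  classical
  exact Finset.prod_subtype_of_mem f fun δ hδ =>
    wordBall_subset hgen m ((wordBall_finite γ m).mem_toFinset.1 hδ)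

theorem exists_word_of_notMem (hgen : Subgroup.closure (Set.range γ) = Γ) {m : ℕ} {δ : Γ}
    (hδ : δ ∉ wordBallFinset γ Γ m) :
    ∃ L, FreeGroup.IsReduced L ∧ m < L.length ∧ wordProd γ L = δ := by
  classical
  obtain ⟨L, hL, hLδ⟩ := exists_reduced_wordProd_eq hgen δ.2
  refine ⟨L, hL, ?_, hLδ⟩
  by_contra! hlen
  exact hδ (Finset.mem_subtype.2 ((wordBall_finite γ m).mem_toFinset.2
    ⟨L, hlen, hL, by rw [lift_mk_eq_wordProd, hLδ]⟩))

end WordBall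

end MumfordCurve

end

/-! ### The main theorem. -/

theorem theorem3p5 {K : Type*} [NontriviallyNormedField K] [IsUltrametricDist K] [CompleteSpace K]
    [IsAlgClosed K] (p : ℝ) (hp : 1 < p) {g : ℕ} (γ : Fin g → PGL(2, K))
    (Γ : Subgroup PGL(2, K)) (hΓ : MumfordCurve.IsSchottky Γ)
    (hgen : Subgroup.closure (Set.range γ) = Γ)
    (hfree : Function.Injective (FreeGroup.lift γ))
    (B B' : Fin g → MumfordCurve.Ball K) (hF : MumfordCurve.IsGoodFundamentalDomain γ B B')
    (m : ℕ) (hm : 1 ≤ m) (i j : Fin g) (a z : OnePoint K)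
    (ha : a ∈ (B' i).closedSet \ (B' i).openSet)
    (hz : z ∈ (B' j).closedSet \ (B' j).openSet) (haz : a ≠ z) :
    (Multipliable (fun δ : Γ =>
        MumfordCurve.factor ((δ : PGL(2, K)) • a) ((δ : PGL(2, K)) • (γ i • a)) z /
          MumfordCurve.factor ((δ : PGL(2, K)) • a) ((δ : PGL(2, K)) • (γ i • a)) (γ j • z)) ∧
      MumfordCurve.thetaQuot Γ a (γ i • a) z (γ j • z) ≠ 0 ∧
      ‖MumfordCurve.thetaTrunc γ m a (γ i • a) z /
            MumfordCurve.thetaTrunc γ m a (γ i • a) (γ j • z) /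
          MumfordCurve.thetaQuot Γ a (γ i • a) z (γ j • z) - 1‖
        ≤ p ^ (-(MumfordCurve.minDist p B B' * m))) ∧
    (OnePoint.infty ∉ MumfordCurve.badPts Γ →
      Multipliable (fun δ : Γ =>
        MumfordCurve.factor ((δ : PGL(2, K)) • a) ((δ : PGL(2, K)) • (γ i • a)) z) ∧
      Multipliable (fun δ : Γ =>
        MumfordCurve.factor ((δ : PGL(2, K)) • a) ((δ : PGL(2, K)) • (γ i • a)) (γ j • z)) ∧
      MumfordCurve.theta Γ a (γ i • a) z ≠ 0 ∧
      MumfordCurve.theta Γ a (γ i • a) (γ j • z) ≠ 0 ∧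
      ‖MumfordCurve.thetaTrunc γ m a (γ i • a) z /
            MumfordCurve.thetaTrunc γ m a (γ i • a) (γ j • z) /
          (MumfordCurve.theta Γ a (γ i • a) z /
            MumfordCurve.theta Γ a (γ i • a) (γ j • z)) - 1‖
        ≤ p ^ (-(MumfordCurve.minDist p B B' * m))) := by
  open MumfordCurve in
  have haF : ∀ h, a ∉ (letterBall B B' h).openSet := hF.notMem_letterBall (k := (i, false)) ha
  have hzF : ∀ h, z ∉ (letterBall B B' h).openSet := hF.notMem_letterBall (k := (j, false)) hz
  have hbF : ∀ h, γ i • a ∉ (letterBall B B' h).openSet :=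
    hF.notMem_letterBall (k := (i, true)) (hF.smul_mem_boundary ha)
  have hwF : ∀ h, γ j • z ∉ (letterBall B B' h).openSet :=
    hF.notMem_letterBall (k := (j, true)) (hF.smul_mem_boundary hz)
  have P := hF.isPingPong hp i haF
  rw [← neg_mul, Real.rpow_mul (by linarith), Real.rpow_natCast]
  set q := p ^ (-minDist p B B') with hq
  have hmem : ∀ k, γ k ∈ Γ := fun k => by simpa [letter] using wordProd_mem hgen [(k, true)]
  -- No factor may vanish or have a zero denominator. As both points lie on boundaries of primed
  -- balls, only the empty word could join them; the other three cases follow by translation in Γ.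
  have hza : ∀ δ ∈ Γ, z ≠ δ • a := by
    intro δ hδ
    obtain ⟨L, hL, rfl⟩ := exists_reduced_wordProd_eq hgen hδ
    by_cases hL0 : L = []
    · simpa [hL0] using haz.symm
    · exact (P.wordProd_smul_ne (k := (i, false)) (l := (j, false)) ha hz (by simp [invLetter])
        hL hL0).symm
  have hzb : ∀ δ ∈ Γ, z ≠ δ • γ i • a := fun δ hδ => by
    simpa [mul_smul] using hza _ (Γ.mul_mem hδ (hmem i))
  have hwa : ∀ δ ∈ Γ, γ j • z ≠ δ • a := fun δ hδ e => by
    refine hza _ (Γ.mul_mem (Γ.inv_mem (hmem j)) hδ) ?_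
    rw [mul_smul, ← e, inv_smul_smul]
  have hwb : ∀ δ ∈ Γ, γ j • z ≠ δ • γ i • a := fun δ hδ => by
    simpa [mul_smul] using hwa _ (Γ.mul_mem hδ (hmem i))
  have hz0 : ∀ δ : Γ, factor ((δ : PGL(2, K)) • a) ((δ : PGL(2, K)) • (γ i • a)) z ≠ 0 :=
    fun δ => factor_ne_zero (hza _ δ.2) (hzb _ δ.2)
  have hw0 : ∀ δ : Γ, factor ((δ : PGL(2, K)) • a) ((δ : PGL(2, K)) • (γ i • a)) (γ j • z) ≠ 0 :=
    fun δ => factor_ne_zero (hwa _ δ.2) (hwb _ δ.2)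
  have hpow : ∀ ε : ℝ, 0 < ε → ∃ n : ℕ, 1 ≤ n ∧ q ^ n ≤ ε := by
    intro ε hε
    obtain ⟨n, hn⟩ := exists_pow_lt_of_lt_one hε P.q_lt_one
    exact ⟨n + 1, by omega,
      (pow_le_pow_of_le_one P.q_pos.le P.q_lt_one.le (by omega)).trans hn.le⟩
  have hcross : ∀ n, 1 ≤ n → ∀ δ ∉ wordBallFinset γ Γ n,
      ‖factor ((δ : PGL(2, K)) • a) ((δ : PGL(2, K)) • (γ i • a)) z /
        factor ((δ : PGL(2, K)) • a) ((δ : PGL(2, K)) • (γ i • a)) (γ j • z) - 1‖ ≤ q ^ n := by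
    intro n hn δ hδ
    rw [factor_div_factor_sub_one (hzb _ δ.2) (hwa _ δ.2) (hwb _ δ.2)]
    obtain ⟨L, hL, hlen, hLδ⟩ := exists_word_of_notMem hgen hδ
    rw [← hLδ]
    exact P.norm_crossDev_le_pow hn hL hlen hzF hwF haF hbF
  have hquot0 := fun δ : Γ => div_ne_zero (hz0 δ) (hw0 δ)
  obtain ⟨Q, hQ0, hQ⟩ := exists_hasProd_ne_zero hquot0 fun ε hε => by
    obtain ⟨n, hn, hnε⟩ := hpow ε hε
    exact ⟨_, fun δ hδ => (hcross n hn δ hδ).trans hnε⟩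
  have hQeq : thetaQuot Γ a (γ i • a) z (γ j • z) = Q := hQ.tprod_eq
  have hest : ‖thetaTrunc γ m a (γ i • a) z / thetaTrunc γ m a (γ i • a) (γ j • z) /
      thetaQuot Γ a (γ i • a) z (γ j • z) - 1‖ ≤ q ^ m := by
    rw [hQeq, thetaTrunc, thetaTrunc, ← Finset.prod_div_distrib, ← prod_wordBallFinset hgen m]
    exact norm_prod_div_sub_one_le hquot0 hQ0 hQ (pow_nonneg P.q_pos.le m)
      (pow_lt_one₀ P.q_pos.le P.q_lt_one (by omega)) _ (hcross m hm)
  refine ⟨⟨hQ.multipliable, hQeq ▸ hQ0, hest⟩, fun hinf => ?_⟩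
  have hletter : ∀ h, letter γ h ∈ Γ := fun h => by simpa using wordProd_mem hgen [h]
  have hne1 := letter_ne_one hfree
  obtain ⟨N, hN⟩ := P.exists_inv_smul_infty_mem (wordProd_mem hgen) hne1
    (fun h => hΓ.hyperbolic _ (hletter h) (hne1 h)) hinf
  have hsmall : ∀ s : OnePoint K, (∀ h, s ∉ (letterBall B B' h).openSet) →
      (∀ δ ∈ Γ, s ≠ δ • γ i • a) → ∀ ε : ℝ, 0 < ε → ∃ S : Finset Γ, ∀ δ ∉ S,
        ‖factor ((δ : PGL(2, K)) • a) ((δ : PGL(2, K)) • (γ i • a)) s - 1‖ ≤ ε := by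
    intro s hsF hsb ε hε
    obtain ⟨n, -, hnε⟩ := hpow ε hε
    refine ⟨wordBallFinset γ Γ (N + 1 + n), fun δ hδ => ?_⟩
    obtain ⟨L, hL, hlen, hLδ⟩ := exists_word_of_notMem hgen hδ
    have hsδ := hsb _ δ.2
    rw [← hLδ] at hsδ ⊢
    exact (P.norm_factor_sub_one_le hN hsF haF hbF n hL hlen hsδ).trans hnε
  obtain ⟨s, hs0, hs⟩ := exists_hasProd_ne_zero hz0 (hsmall z hzF hzb)
  obtain ⟨t, ht0, ht⟩ := exists_hasProd_ne_zero hw0 (hsmall _ hwF hwb)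
  have hseq : theta Γ a (γ i • a) z = s := hs.tprod_eq
  have hteq : theta Γ a (γ i • a) (γ j • z) = t := ht.tprod_eq
  refine ⟨hs.multipliable, ht.multipliable, hseq ▸ hs0, hteq ▸ ht0, ?_⟩
  -- Both products converge and the denominator is non-zero, so the quotient is the product of
  -- quotients and inherits its estimate.
  have hst : theta Γ a (γ i • a) z / theta Γ a (γ i • a) (γ j • z) =
      thetaQuot Γ a (γ i • a) z (γ j • z) := by
    rw [hseq, hteq]
    exact (hs.div₀ ht ht0).tprod_eq.symm
  rw [hst]
  exact hest
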